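/- Let $G$ be a locally compact group acting continuously on a locally compact Hausdorff space $X$ (that is, $(s,x)\mapsto s\cdot x$ from $G\times X$ to $X$ is continuous). Assume that $X$ is first countable and that the action is pointwise proper, i.e. for every $x\in X$ and every compact $K\subseteq X$ the set $\{s\in G : s\cdot x\in K\}$ is compact. Let $\alpha$ be the associated action of $G$ on $C_0(X)$, $\alpha_s(f)(x)=f(s^{-1}\cdot x)$. Then all orbits are closed in $X$, and $\alpha$ is quasi-regular: for every irreducible covariant representation $(\pi,U)$ of $(C_0(X),G)$ on a Hilbert space there is an orbit $G\cdot x$ such that $$\ker\pi=\{f\in C_0(X) : f|_{G\cdot x}=0\}.$$ Here a covariant representation $(\pi,U)$ on a complex Hilbert space $H$ consists of a nondegenerate $*$-representation $\pi$ of $C_0(X)$ on $H$ and a strongly continuous unitary representation $U$ of $G$ on $H$ with $\pi(\alpha_s(f))=U_s\pi(f)U_s^*$ for all $s\in G$, $f\in C_0(X)$; it is irreducible if $H\neq 0$ and the only closed subspaces of $H$ invariant under all $\pi(f)$ and all $U_s$ are $0$ and $H$. -/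

import Mathlib

universe w

noncomputable section

open scoped Topology Pointwise ZeroAtInfty

/-- The transporter `((U, V)) = {s ∈ G : sU ∩ V ≠ ∅}`. -/
def transporter (G : Type*) {X : Type*} [Group G] [MulAction G X] (U V : Set X) : Set G :=
  {s : G | ((s • U) ∩ V).Nonempty}

/-- A `G`-space `X` is pointwise proper if `(({x}, K))` is compact for every point `x` and every
compact `K ⊆ X`. -/
def IsPointwiseProper (G X : Type*) [Group G] [TopologicalSpace G] [TopologicalSpace X]
    [MulAction G X] : Prop :=
  ∀ (x : X) (K : Set X), IsCompact K → IsCompact (transporter G {x} K)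

section Associated

variable {G X : Type*} [Group G] [TopologicalSpace X] [MulAction G X] [ContinuousConstSMul G X]

/-- The translate `x ↦ f (s⁻¹ • x)` of a function `f ∈ C₀(X)`. -/
def translateC0 (s : G) (f : C₀(X, ℂ)) : C₀(X, ℂ) where
  toFun x := f (s⁻¹ • x)
  continuous_toFun := f.continuous.comp (continuous_const_smul s⁻¹)
  zero_at_infty' := f.zero_at_infty'.comp
    (Homeomorph.smul (s⁻¹ : G) : X ≃ₜ X).isClosedEmbedding.tendsto_cocompact

@[simp] theorem translateC0_apply (s : G) (f : C₀(X, ℂ)) (x : X) :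
    translateC0 s f x = f (s⁻¹ • x) := rfl

variable (G X) in
/-- The action `α` of `G` on the C*-algebra `C₀(X)` by `*`-automorphisms associated with the
`G`-space `X`, `α_s(f)(x) = f(s⁻¹ x)`. -/
def associatedAction : G →* (C₀(X, ℂ) ≃⋆ₐ[ℂ] C₀(X, ℂ)) where
  toFun s :=
    { toFun := translateC0 s
      invFun := translateC0 s⁻¹
      left_inv := fun f => by ext x; simp
      right_inv := fun f => by ext x; simp
      map_mul' := fun f g => by ext x; simp
      map_add' := fun f g => by ext x; simp
      map_star' := fun f => by ext x; simp
      map_smul' := fun c f => by ext x; simp }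
  map_one' := by
    ext f x
    change f ((1 : G)⁻¹ • x) = f x
    simp
  map_mul' s t := by
    ext f x
    change f ((s * t)⁻¹ • x) = f (t⁻¹ • s⁻¹ • x)
    rw [mul_inv_rev, mul_smul]

@[simp] theorem associatedAction_apply (s : G) (f : C₀(X, ℂ)) (x : X) :
    associatedAction G X s f x = f (s⁻¹ • x) := rfl

end Associated

/-- A covariant representation `(π, U)` of an action `α` of `G` on a C*-algebra `A` on a Hilbert
space `H`: a nondegenerate `*`-representation `π` of `A` and a strongly continuous unitary
representation `U` of `G` with `π(α_s(a)) = U_s π(a) U_s*`. -/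
structure CovariantRepresentation {G A : Type*} [Group G] [TopologicalSpace G]
    [NonUnitalCStarAlgebra A] (α : G →* (A ≃⋆ₐ[ℂ] A))
    (H : Type*) [NormedAddCommGroup H] [InnerProductSpace ℂ H] [CompleteSpace H] where
  /-- the representation of the algebra -/
  π : A →⋆ₙₐ[ℂ] (H →L[ℂ] H)
  /-- the unitary representation of the group -/
  U : G →* unitary (H →L[ℂ] H)
  nondegenerate : (Submodule.span ℂ {η : H | ∃ (a : A) (ξ : H), η = π a ξ}).topologicalClosure = ⊤
  strongly_continuous : ∀ ξ : H, Continuous fun s : G => (U s : H →L[ℂ] H) ξ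
  covariant : ∀ (s : G) (a : A),
    π (α s a) = (U s : H →L[ℂ] H) * π a * star (U s : H →L[ℂ] H)

/-- `(π, U)` is irreducible: `H ≠ 0`, and the only closed subspaces of `H` invariant under all
`π(a)` and all `U_s` are `0` and `H`. -/
def CovariantRepresentation.IsIrreducible {G A : Type*} [Group G] [TopologicalSpace G]
    [NonUnitalCStarAlgebra A] {α : G →* (A ≃⋆ₐ[ℂ] A)}
    {H : Type*} [NormedAddCommGroup H] [InnerProductSpace ℂ H] [CompleteSpace H]
    (ρ : CovariantRepresentation α H) : Prop :=
  Nontrivial H ∧ ∀ K : Submodule ℂ H, IsClosed (K : Set H) →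
    (∀ (a : A), ∀ ξ ∈ K, ρ.π a ξ ∈ K) →
    (∀ (s : G), ∀ ξ ∈ K, (ρ.U s : H →L[ℂ] H) ξ ∈ K) → K = ⊥ ∨ K = ⊤

/-- Quasi-regularity of the associated action of `G` on `C₀(X)` (for a `G`-space with closed
orbits): for every irreducible covariant representation `(π, U)` there is an orbit `G • x` such
that `ker π = {f ∈ C₀(X) : f = 0 on G • x}`. -/
def IsQuasiRegular (G X : Type*) [Group G] [TopologicalSpace G] [TopologicalSpace X]
    [MulAction G X] [ContinuousConstSMul G X] : Prop :=
  ∀ (H : Type w) [NormedAddCommGroup H] [InnerProductSpace ℂ H] [CompleteSpace H]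
    (ρ : CovariantRepresentation (associatedAction G X) H), ρ.IsIrreducible →
    ∃ x : X, {f : C₀(X, ℂ) | ρ.π f = 0} = {f : C₀(X, ℂ) | ∀ y ∈ MulAction.orbit G x, f y = 0}

end

open scoped Topology Pointwise ZeroAtInfty

/-! ### Orbit closures and a Baire category argument -/

section Orbits

variable {G X : Type*} [Group G] [TopologicalSpace X] [MulAction G X]

/-! The kernel of `π` is the ideal of functions vanishing on a nonempty closed invariant set `F =
kerZeros π` (`apply_eq_zero_iff_forall_kerZeros`). Irreducibility makes this kernel prime among
invariant ideals (`IsIrreducible.π_eq_zero_or`), so invariant open sets that meet `F` meet each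
other inside `F`. Given `x ∈ F`, saturating a countable neighbourhood base at `x` yields dense open
subsets of `F`; by Baire, the points of `F` whose orbit closure contains `x` are dense. Orbits being
closed, these points lie in `G • x`, which is thus dense and closed in `F`. Properness serves only
to close the orbits. -/

/-- Orbits of a pointwise proper action on a locally compact Hausdorff space are closed. -/
theorem IsPointwiseProper.isClosed_orbit [TopologicalSpace G] [LocallyCompactSpace X]
    [T2Space X] [ContinuousSMul G X]
    (hproper : IsPointwiseProper G X) (x : X) : IsClosed (MulAction.orbit G x) := by
  refine isClosed_of_closure_subset fun y hy => ?_
  obtain ⟨K, hK, hyK⟩ := exists_compact_mem_nhds y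
  have hcont : Continuous fun s : G => s • x := by fun_prop
  -- Inside the compact neighbourhood `K` of `y`, the orbit is covered by the continuous image of a
  -- compact set.
  have hclosed : IsClosed ((fun s : G => s • x) '' transporter G {x} K) :=
    ((hproper x K hK).image hcont).isClosed
  have hsub : MulAction.orbit G x ∩ K ⊆ (fun s : G => s • x) '' transporter G {x} K := by
    rintro _ ⟨⟨s, rfl⟩, hs⟩
    exact ⟨s, ⟨s • x, by simp, hs⟩, rfl⟩
  have hy' : y ∈ closure (MulAction.orbit G x ∩ K) :=
    mem_closure_iff_nhds.2 fun t ht => by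
      obtain ⟨z, ⟨hzt, hzK⟩, hz⟩ := mem_closure_iff_nhds.1 hy _ (Filter.inter_mem ht hyK)
      exact ⟨z, hzt, hz, hzK⟩
  obtain ⟨s, -, rfl⟩ := closure_minimal hsub hclosed hy'
  exact MulAction.mem_orbit x s

/-- Let `F` be a nonempty closed invariant subset of a locally compact Hausdorff space that is
first countable. If all orbits are closed and any two nonempty invariant relatively open subsets
of `F` meet, then `F` is an orbit. -/
theorem exists_eq_orbit_of_invariant_open_inter_nonempty [LocallyCompactSpace X] [T2Space X]
    [FirstCountableTopology X] [ContinuousConstSMul G X]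
    (horbit : ∀ x : X, IsClosed (MulAction.orbit G x)) {F : Set X} (hF : IsClosed F)
    (hne : F.Nonempty) (hinv : ∀ (s : G), ∀ x ∈ F, s • x ∈ F)
    (hirr : ∀ U V : Set X, IsOpen U → IsOpen V → (∀ (s : G), ∀ x ∈ U, s • x ∈ U) →
      (∀ (s : G), ∀ x ∈ V, s • x ∈ V) → (F ∩ U).Nonempty → (F ∩ V).Nonempty →
      (F ∩ (U ∩ V)).Nonempty) :
    ∃ x, F = MulAction.orbit G x := by
  obtain ⟨x, hx⟩ := hne
  obtain ⟨B, hB⟩ := (𝓝 x).exists_antitone_basis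
  have hopen (W : Set X) (hW : IsOpen W) : IsOpen (⋃ s : G, s • W) :=
    isOpen_iUnion fun s => hW.smul s
  have hsat (W : Set X) (s : G) : ∀ z ∈ ⋃ t : G, t • W, s • z ∈ ⋃ t : G, t • W := by
    intro z hz
    obtain ⟨t, w, hw, rfl⟩ := Set.mem_iUnion.1 hz
    exact Set.mem_iUnion.2 ⟨s * t, w, hw, mul_smul s t w⟩
  have hself (W : Set X) : W ⊆ ⋃ t : G, t • W := fun w hw =>
    Set.mem_iUnion.2 ⟨1, w, hw, one_smul G w⟩
  have : LocallyCompactSpace F := hF.isClosedEmbedding_subtypeVal.locallyCompactSpace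
  have hdense : Dense (⋂ n, ((↑) : F → X) ⁻¹' ⋃ s : G, s • interior (B n)) := by
    refine dense_iInter_of_isOpen_nat
      (fun n => (hopen _ isOpen_interior).preimage continuous_subtype_val) fun n => ?_
    rw [dense_iff_inter_open]
    rintro _ ⟨V, hV, rfl⟩ ⟨v, hv⟩
    obtain ⟨z, hzF, hzV, hzB⟩ := hirr (⋃ s : G, s • V) (⋃ s : G, s • interior (B n))
      (hopen V hV) (hopen _ isOpen_interior) (hsat _) (hsat _) ⟨v, v.2, hself V hv⟩
      ⟨x, hx, hself _ (mem_interior_iff_mem_nhds.2 (hB.1.mem_of_mem trivial))⟩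
    -- The common point lies only in the saturation of `V`; translating by `t⁻¹` brings it into `V`
    -- and keeps it in the other two invariant sets.
    obtain ⟨t, w, hw, rfl⟩ := Set.mem_iUnion.1 hzV
    have hwF : w ∈ F := by simpa using hinv t⁻¹ _ hzF
    exact ⟨⟨w, hwF⟩, hw, by simpa using hsat _ t⁻¹ _ hzB⟩
  have hsub : (⋂ n, ((↑) : F → X) ⁻¹' ⋃ s : G, s • interior (B n)) ⊆
      (↑) ⁻¹' MulAction.orbit G x := by
    intro z hz
    have hxz : x ∈ closure (MulAction.orbit G (z : X)) := by
      refine (mem_closure_iff_nhds_basis' hB.1).2 fun n _ => ?_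
      obtain ⟨t, w, hw, htw⟩ := Set.mem_iUnion.1 (Set.mem_iInter.1 hz n)
      refine ⟨w, interior_subset hw, t⁻¹, ?_⟩
      change t⁻¹ • (z : X) = w
      rw [← htw]
      exact inv_smul_smul t w
    rw [(horbit z).closure_eq] at hxz
    exact MulAction.mem_orbit_symm.1 hxz
  refine ⟨x, Set.Subset.antisymm (fun y hy => ?_) ?_⟩
  · have hcl := closure_minimal hsub ((horbit x).preimage continuous_subtype_val)
    exact hcl (hdense ⟨y, hy⟩)
  · rintro _ ⟨s, rfl⟩
    exact hinv s x hx

end Orbits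

/-! ### Closed ideals of `C₀(X)` as vanishing ideals -/

section VanishingIdeals

variable {X : Type*} [TopologicalSpace X]

/-- The quotient of `f ∈ C₀(X)` by a continuous real function bounded below by `δ > 0`. -/
noncomputable def divC0 (f : C₀(X, ℂ)) (g : C(X, ℝ)) {δ : ℝ} (hδ : 0 < δ) (hg : ∀ x, δ ≤ g x) :
    C₀(X, ℂ) where
  toFun x := f x / (g x : ℂ)
  continuous_toFun := by
    have hne (x : X) : (g x : ℂ) ≠ 0 := Complex.ofReal_ne_zero.2 (hδ.trans_le (hg x)).ne'
    exact f.continuous.div (Complex.continuous_ofReal.comp g.continuous) hne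
  zero_at_infty' := by
    have h : Filter.Tendsto (fun x => ‖f x‖ / δ) (Filter.cocompact X) (𝓝 0) := by
      simpa using (f.zero_at_infty'.norm.div_const δ)
    refine squeeze_zero_norm (fun x => ?_) h
    have := hg x
    rw [norm_div, Complex.norm_real, Real.norm_of_nonneg (hδ.le.trans this)]
    gcongr

theorem ZeroAtInftyContinuousMap.isCompact_le_norm (f : C₀(X, ℂ)) {ε : ℝ} (hε : 0 < ε) :
    IsCompact {x | ε ≤ ‖f x‖} := by
  have h : {x | ‖f x‖ < ε} ∈ Filter.cocompact X := by
    have := f.zero_at_infty'.norm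
    rw [norm_zero] at this
    exact this.eventually (gt_mem_nhds hε)
  obtain ⟨K, hK, hKs⟩ := Filter.mem_cocompact.1 h
  refine hK.of_isClosed_subset (isClosed_le continuous_const f.continuous.norm) fun x hx => ?_
  by_contra hxK
  have hlt : ‖f x‖ < ε := hKs hxK
  exact hlt.not_ge hx

theorem ZeroAtInftyContinuousMap.exists_one_of_mem_isOpen [LocallyCompactSpace X] [T2Space X]
    {U : Set X} (hU : IsOpen U) {x : X} (hx : x ∈ U) :
    ∃ f : C₀(X, ℂ), f x = 1 ∧ ∀ y ∉ U, f y = 0 := by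
  obtain ⟨f, hf1, hf0, hfc, -⟩ := exists_continuous_one_zero_of_isCompact
    (isCompact_singleton (x := x)) hU.isClosed_compl
    (Set.disjoint_singleton_left.2 fun h => h hx)
  have hsupp : HasCompactSupport fun y => (f y : ℂ) :=
    hfc.comp_left (g := Complex.ofReal) Complex.ofReal_zero
  refine ⟨⟨⟨fun y => (f y : ℂ), by fun_prop⟩, hsupp.is_zero_at_infty⟩, ?_, fun y hy => ?_⟩
  · change (f x : ℂ) = 1
    simp [hf1 rfl]
  · change (f y : ℂ) = 0
    simp [hf0 hy]

variable {B : Type*} [NonUnitalCStarAlgebra B]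

/-- The set of common zeros of the kernel of a `*`-homomorphism of `C₀(X)`. -/
def kerZeros (φ : C₀(X, ℂ) →⋆ₙₐ[ℂ] B) : Set X :=
  {x | ∀ f : C₀(X, ℂ), φ f = 0 → f x = 0}

theorem isClosed_kerZeros (φ : C₀(X, ℂ) →⋆ₙₐ[ℂ] B) : IsClosed (kerZeros φ) := by
  simp only [kerZeros, Set.ofPred_forall]
  exact isClosed_iInter fun f => isClosed_iInter fun _ =>
    isClosed_eq f.continuous continuous_const

/-- On a compact set disjoint from the zeros of the kernel, some nonnegative element of the kernel
is strictly positive. -/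
theorem exists_mem_ker_pos_on_isCompact (φ : C₀(X, ℂ) →⋆ₙₐ[ℂ] B) {K : Set X} (hK : IsCompact K)
    (hd : Disjoint K (kerZeros φ)) :
    ∃ h : C₀(X, ℂ), φ h = 0 ∧ (∀ x, 0 ≤ (h x).re ∧ (h x).im = 0) ∧ ∀ x ∈ K, 0 < (h x).re := by
  refine hK.induction_on (p := fun K => ∃ h : C₀(X, ℂ), φ h = 0 ∧
    (∀ x, 0 ≤ (h x).re ∧ (h x).im = 0) ∧ ∀ x ∈ K, 0 < (h x).re) ?_ ?_ ?_ ?_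
  · exact ⟨0, map_zero φ, by simp, by simp⟩
  · rintro s t hst ⟨h, h0, hp, hpos⟩
    exact ⟨h, h0, hp, fun x hx => hpos x (hst hx)⟩
  · rintro s t ⟨h, h0, hp, hpos⟩ ⟨k, k0, kp, kpos⟩
    refine ⟨h + k, by simp [h0, k0], fun x => ?_, fun x hx => ?_⟩
    · simpa [(hp x).2, (kp x).2] using add_nonneg (hp x).1 (kp x).1
    · simp only [ZeroAtInftyContinuousMap.add_apply, Complex.add_re]
      rcases hx with hx | hx
      · exact add_pos_of_pos_of_nonneg (hpos x hx) (kp x).1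
      · exact add_pos_of_nonneg_of_pos (hp x).1 (kpos x hx)
  · intro x hx
    have hxF : x ∉ kerZeros φ := Set.disjoint_left.1 hd hx
    simp only [kerZeros, Set.mem_ofPred_eq, not_forall] at hxF
    obtain ⟨f, hf, hfx⟩ := hxF
    have hval (y : X) : (star f * f) y = ((‖f y‖ ^ 2 : ℝ) : ℂ) := by
      simp [Complex.conj_mul']
    refine ⟨{y | f y ≠ 0}, mem_nhdsWithin_of_mem_nhds
      ((isOpen_ne_fun f.continuous continuous_const).mem_nhds hfx), star f * f, by simp [hf],
      fun y => ?_, fun y hy => ?_⟩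
    · rw [hval, Complex.ofReal_re, Complex.ofReal_im]
      exact ⟨by positivity, rfl⟩
    · rw [hval, Complex.ofReal_re]
      have : 0 < ‖f y‖ := norm_pos_iff.2 hy
      positivity

/-- The kernel of a `*`-homomorphism of `C₀(X)` consists of the functions vanishing on its set of
common zeros. -/
theorem apply_eq_zero_iff_forall_kerZeros (φ : C₀(X, ℂ) →⋆ₙₐ[ℂ] B) (f : C₀(X, ℂ)) :
    φ f = 0 ↔ ∀ x ∈ kerZeros φ, f x = 0 := by
  refine ⟨fun hf x hx => hx f hf, fun hf => ?_⟩
  rw [← norm_le_zero_iff]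
  refine le_of_forall_pos_le_add fun ε hε => ?_
  rw [zero_add]
  have hK := f.isCompact_le_norm hε
  have hd : Disjoint {x | ε ≤ ‖f x‖} (kerZeros φ) := by
    rw [Set.disjoint_left]
    intro x hx hxF
    rw [Set.mem_ofPred_eq, hf x hxF, norm_zero] at hx
    exact hε.not_ge hx
  obtain ⟨h, h0, hp, hpos⟩ := exists_mem_ker_pos_on_isCompact φ hK hd
  obtain ⟨c, hc, hcK⟩ : ∃ c > 0, ∀ x, ε ≤ ‖f x‖ → c ≤ (h x).re := by
    rcases Set.eq_empty_or_nonempty {x | ε ≤ ‖f x‖} with he | hne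
    · exact ⟨1, one_pos, fun x hx => (Set.eq_empty_iff_forall_notMem.1 he x hx).elim⟩
    · obtain ⟨x, hx, hmin⟩ := hK.exists_isMinOn hne
        (Complex.continuous_re.comp h.continuous).continuousOn
      exact ⟨(h x).re, hpos x hx, fun y hy => hmin hy⟩
  have hf0 := norm_nonneg f
  -- With `q = f / (h + δ)`, the error `f - h * q` is `f * δ / (h + δ)`. Where `ε ≤ ‖f x‖` one has
  -- `c ≤ h`, and this `δ` makes the error at most `ε`; elsewhere the factor is at most `1`.
  set δ : ℝ := c * ε / (‖f‖ + 1) with hδ_def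
  have hδ : 0 < δ := by positivity
  let g : C(X, ℝ) := ⟨fun x => (h x).re + δ, by fun_prop⟩
  let q : C₀(X, ℂ) := divC0 f g hδ fun x => le_add_of_nonneg_left (hp x).1
  have hq : φ (h * q) = 0 := by rw [map_mul, h0, zero_mul]
  have hle : ‖f - h * q‖ ≤ ε := by
    rw [← ZeroAtInftyContinuousMap.norm_toBCF_eq_norm, BoundedContinuousFunction.norm_le hε.le]
    intro x
    change ‖f x - h x * (f x / (((h x).re + δ : ℝ) : ℂ))‖ ≤ ε
    have hx0 := (hp x).1
    have hsum : 0 < (h x).re + δ := by positivity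
    have hh : h x = ((h x).re : ℂ) := Complex.ext rfl (by simp [(hp x).2])
    have hdiff : f x - h x * (f x / (((h x).re + δ : ℝ) : ℂ)) =
        f x * ((δ / ((h x).re + δ) : ℝ) : ℂ) := by
      have hne : (((h x).re : ℂ) + δ) ≠ 0 := by exact_mod_cast hsum.ne'
      rw [hh]
      push_cast [Complex.ofReal_re]
      field_simp
      ring
    rw [hdiff, norm_mul, Complex.norm_real, Real.norm_of_nonneg (by positivity), ← mul_div_assoc,
      div_le_iff₀ hsum]
    have hfx : ‖f x‖ ≤ ‖f‖ := f.toBCF.norm_coe_le_norm x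
    by_cases hx : ε ≤ ‖f x‖
    · have h1 : δ * (‖f‖ + 1) = c * ε := by rw [hδ_def]; field_simp
      have h2 := hcK x hx
      nlinarith
    · push Not at hx
      nlinarith
  calc ‖φ f‖ = ‖φ (f - h * q)‖ := by rw [map_sub, hq, sub_zero]
    _ ≤ ‖f - h * q‖ := NonUnitalStarAlgHom.norm_apply_le φ _
    _ ≤ ε := hle

end VanishingIdeals

/-! ### Primeness of the kernel of an irreducible covariant representation -/

section Irreducible

namespace CovariantRepresentation

variable {G A : Type*} [Group G] [TopologicalSpace G] [NonUnitalCStarAlgebra A]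
  {α : G →* (A ≃⋆ₐ[ℂ] A)}
  {H : Type*} [NormedAddCommGroup H] [InnerProductSpace ℂ H] [CompleteSpace H]
  (ρ : CovariantRepresentation α H)

theorem U_apply_π_apply (s : G) (a : A) (ξ : H) :
    (ρ.U s : H →L[ℂ] H) (ρ.π a ξ) = ρ.π (α s a) ((ρ.U s : H →L[ℂ] H) ξ) := by
  have h : ρ.π (α s a) * (ρ.U s : H →L[ℂ] H) = (ρ.U s : H →L[ℂ] H) * ρ.π a := by
    rw [ρ.covariant, mul_assoc, Unitary.coe_star_mul_self, mul_one]
  exact (DFunLike.congr_fun h ξ).symm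

theorem π_α_eq_zero {a : A} (ha : ρ.π a = 0) (s : G) : ρ.π (α s a) = 0 := by
  rw [ρ.covariant, ha, mul_zero, zero_mul]

/-- The essential subspace of a set of elements of the algebra. -/
def essentialSubspace (I : Set A) : Submodule ℂ H :=
  (Submodule.span ℂ {η : H | ∃ a ∈ I, ∃ ξ : H, η = ρ.π a ξ}).topologicalClosure

variable {ρ}

theorem π_apply_mem_essentialSubspace {I : Set A} {a : A} (ha : a ∈ I) (ξ : H) :
    ρ.π a ξ ∈ ρ.essentialSubspace I :=
  Submodule.le_topologicalClosure _ (Submodule.subset_span ⟨a, ha, ξ, rfl⟩)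

theorem essentialSubspace_le {I : Set A} {K : Submodule ℂ H} (hK : IsClosed (K : Set H))
    (h : ∀ a ∈ I, ∀ ξ, ρ.π a ξ ∈ K) : ρ.essentialSubspace I ≤ K := by
  refine Submodule.topologicalClosure_minimal _ (Submodule.span_le.2 ?_) hK
  rintro _ ⟨a, ha, ξ, rfl⟩
  exact h a ha ξ

theorem essentialSubspace_le_comap {I : Set A} {K : Submodule ℂ H} (hK : IsClosed (K : Set H))
    (T : H →L[ℂ] H) (h : ∀ a ∈ I, ∀ ξ, T (ρ.π a ξ) ∈ K) :
    ρ.essentialSubspace I ≤ K.comap (T : H →ₗ[ℂ] H) :=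
  essentialSubspace_le (hK.preimage T.continuous) h

/-- The kernel of an irreducible covariant representation is prime with respect to invariant
ideals. -/
theorem IsIrreducible.π_eq_zero_or (hρ : ρ.IsIrreducible) {I J : Set A}
    (hJmul : ∀ a, ∀ b ∈ J, a * b ∈ J) (hJα : ∀ s, ∀ b ∈ J, α s b ∈ J)
    (hIJ : ∀ a ∈ I, ∀ b ∈ J, ρ.π (a * b) = 0) :
    (∀ a ∈ I, ρ.π a = 0) ∨ ∀ b ∈ J, ρ.π b = 0 := by
  have hclosed : IsClosed (ρ.essentialSubspace J : Set H) :=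
    Submodule.isClosed_topologicalClosure _
  -- The closed span of `π(J)H` is invariant, hence `0` or `H`. If `0`, `π` kills `J`; if `H`, each
  -- `π a` with `a ∈ I` vanishes on a dense subspace.
  rcases hρ.2 (ρ.essentialSubspace J) hclosed
    (fun a => essentialSubspace_le_comap hclosed (ρ.π a) fun b hb ξ => by
      have := π_apply_mem_essentialSubspace (ρ := ρ) (hJmul a b hb) ξ
      rwa [map_mul] at this)
    (fun s => essentialSubspace_le_comap hclosed (ρ.U s) fun b hb ξ => by
      rw [U_apply_π_apply]
      exact π_apply_mem_essentialSubspace (hJα s b hb) _) with h | h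
  · refine Or.inr fun b hb => ContinuousLinearMap.ext fun ξ => ?_
    have := π_apply_mem_essentialSubspace (ρ := ρ) hb ξ
    rwa [h, Submodule.mem_bot] at this
  · refine Or.inl fun a ha => ContinuousLinearMap.ext fun ξ => ?_
    have hle := essentialSubspace_le_comap (ρ := ρ) (I := J) (K := (⊥ : Submodule ℂ H))
      (by simp) (ρ.π a) fun b hb η => by
        have := hIJ a ha b hb
        rw [map_mul] at this
        exact (Submodule.mem_bot ℂ).2 (DFunLike.congr_fun this η)
    rw [h] at hle
    exact (Submodule.mem_bot ℂ).1 (hle (Submodule.mem_top (x := ξ)))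

theorem exists_π_ne_zero [Nontrivial H] (ρ : CovariantRepresentation α H) :
    ∃ a, ρ.π a ≠ 0 := by
  by_contra! h
  have hspan : Submodule.span ℂ {η : H | ∃ (a : A) (ξ : H), η = ρ.π a ξ} = ⊥ := by
    rw [Submodule.span_eq_bot]
    rintro _ ⟨a, ξ, rfl⟩
    rw [h a, _root_.zero_apply]
  have htop := ρ.nondegenerate
  rw [hspan, (Submodule.closed_of_finiteDimensional ⊥).submodule_topologicalClosure_eq] at htop
  exact bot_ne_top htop

end CovariantRepresentation

end Irreducible

/-- If all orbits of `G` in a first countable locally compact Hausdorff space are closed, then the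
associated action on `C₀(X)` is quasi-regular. -/
theorem isQuasiRegular_of_isClosed_orbit {G X : Type*} [Group G] [TopologicalSpace G]
    [TopologicalSpace X] [LocallyCompactSpace X] [T2Space X] [FirstCountableTopology X]
    [MulAction G X] [ContinuousConstSMul G X]
    (horbit : ∀ x : X, IsClosed (MulAction.orbit G x)) : IsQuasiRegular.{w} G X := by
  intro H _ _ _ ρ hρ
  have := hρ.1
  have hne : (kerZeros ρ.π).Nonempty := by
    obtain ⟨f, hf⟩ := ρ.exists_π_ne_zero
    by_contra h
    rw [Set.not_nonempty_iff_eq_empty] at h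
    exact hf ((apply_eq_zero_iff_forall_kerZeros ρ.π f).2 (by simp [h]))
  have hinv (s : G) (x : X) (hx : x ∈ kerZeros ρ.π) : s • x ∈ kerZeros ρ.π := fun f hf => by
    have := hx _ (ρ.π_α_eq_zero hf s⁻¹)
    rwa [associatedAction_apply, inv_inv] at this
  have hnonzero (U : Set X) (hU : IsOpen U) (h : (kerZeros ρ.π ∩ U).Nonempty) :
      ¬ ∀ f ∈ {f : C₀(X, ℂ) | ∀ y ∉ U, f y = 0}, ρ.π f = 0 := by
    intro h0
    obtain ⟨x, hxF, hxU⟩ := h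
    obtain ⟨f, hf1, hf0⟩ := ZeroAtInftyContinuousMap.exists_one_of_mem_isOpen hU hxU
    exact one_ne_zero (hf1.symm.trans (hxF f (h0 f hf0)))
  obtain ⟨x, hx⟩ := exists_eq_orbit_of_invariant_open_inter_nonempty horbit
    (isClosed_kerZeros ρ.π) hne hinv fun U V hU hV _ hVinv hFU hFV => by
      -- If `F ∩ U ∩ V` were empty, products of functions supported in `U` and in `V` would vanish
      -- on `F`, so `π` would kill one of the two ideals.
      by_contra hUV
      rcases hρ.π_eq_zero_or (I := {f : C₀(X, ℂ) | ∀ y ∉ U, f y = 0})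
        (J := {f : C₀(X, ℂ) | ∀ y ∉ V, f y = 0})
        (fun a b hb y hy => by simp [hb y hy])
        (fun s b hb y hy => hb _ fun h => hy (by simpa using hVinv s _ h))
        (fun a ha b hb => (apply_eq_zero_iff_forall_kerZeros ρ.π _).2 fun y hy => by
          by_cases hyU : y ∈ U
          · have hyV : y ∉ V := fun hyV => hUV ⟨y, hy, hyU, hyV⟩
            simp [hb y hyV]
          · simp [ha y hyU]) with h | h
      · exact hnonzero U hU hFU h
      · exact hnonzero V hV hFV h
  refine ⟨x, Set.ext fun f => ?_⟩
  rw [Set.mem_ofPred_eq, apply_eq_zero_iff_forall_kerZeros, hx, Set.mem_ofPred_eq]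

theorem mainTheorem5 (G X : Type*) [Group G] [TopologicalSpace G]
    [IsTopologicalGroup G] [LocallyCompactSpace G]
    [TopologicalSpace X] [LocallyCompactSpace X] [T2Space X] [FirstCountableTopology X]
    [MulAction G X] [ContinuousSMul G X]
    (hproper : IsPointwiseProper G X) :
    (∀ x : X, IsClosed (MulAction.orbit G x)) ∧ IsQuasiRegular.{w} G X := by
  exact ⟨hproper.isClosed_orbit, isQuasiRegular_of_isClosed_orbit hproper.isClosed_orbit⟩
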